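/- Let $F$ be a field of characteristic not $2$. A (right) Malcev dialgebra over $F$ is an $F$-vector space with a bilinear operation $ab$ satisfying \[ a(bc)+a(cb)=0,\qquad ((ab)c)d-((ad)b)c-(a(cd))b-(ac)(bd)-a((bc)d)=0 . \] On a Malcev dialgebra consider the trilinear operation \[ \langle a,b,c\rangle = 2(ab)c+a(bc)+(ac)b . \] The defining identities of Leibniz triple systems are \[ \langle a,\langle b,c,d\rangle,e\rangle=\langle\langle a,b,c\rangle,d,e\rangle-\langle\langle a,c,b\rangle,d,e\rangle-\langle\langle a,d,b\rangle,c,e\rangle+\langle\langle a,d,c\rangle,b,e\rangle, \] \[ \langle a,b,\langle c,d,e\rangle\rangle=\langle\langle a,b,c\rangle,d,e\rangle-\langle\langle a,b,d\rangle,c,e\rangle-\langle\langle a,b,e\rangle,c,d\rangle+\langle\langle a,b,e\rangle,d,c\rangle . \] (1) In every Malcev dialgebra over $F$ the operation $\langle-,-,-\rangle$ satisfies these two identities. (2) Suppose moreover that the characteristic of $F$ is not $3$. Then every polynomial identity of degree $5$ (an element of degree $5$ of the free trilinear algebra over $F$ on countably many generators) which is satisfied by $\langle-,-,-\rangle$ in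 every Malcev dialgebra over $F$ is a consequence of these two identities, that is, it lies in the smallest subspace of the free trilinear algebra that contains them, is an ideal for the trilinear operation, and is closed under substitution of arbitrary elements for the generators. -/

import Mathlib

universe u v w

/-- A bilinear product on an `F`-vector space. -/
abbrev BilinOp (F : Type u) (V : Type v) [Field F] [AddCommGroup V] [Module F V] :=
  V →ₗ[F] V →ₗ[F] V

/-- A trilinear operation on an `F`-vector space. -/
abbrev TrilinOp (F : Type u) (V : Type v) [Field F] [AddCommGroup V] [Module F V] :=
  V →ₗ[F] V →ₗ[F] V →ₗ[F] V

section Structures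

variable {F : Type u} {V : Type v} [Field F] [AddCommGroup V] [Module F V]

/-- The product `m` makes `V` into a (right) Malcev dialgebra (over a field of characteristic
not `2`): right anticommutativity and the di-Malcev identity hold. -/
structure IsMalcevDialgebra (m : BilinOp F V) : Prop where
  /-- `a(bc) + a(cb) = 0` -/
  right_anticomm : ∀ a b c : V, m a (m b c) + m a (m c b) = 0
  /-- `((ab)c)d - ((ad)b)c - (a(cd))b - (ac)(bd) - a((bc)d) = 0` -/
  di_malcev : ∀ a b c d : V,
    m (m (m a b) c) d - m (m (m a d) b) c - m (m a (m c d)) b - m (m a c) (m b d)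
      - m a (m (m b c) d) = 0

/-- The trilinear operation `⟨a,b,c⟩ = 2(ab)c + a(bc) + (ac)b`. -/
def ltp (m : BilinOp F V) : TrilinOp F V :=
  LinearMap.mk₂ F (fun a b => (2 : F) • m (m a b) + m a ∘ₗ m b + m.flip b ∘ₗ m a)
    (by intro a a' b; ext c; simp; abel)
    (by intro r a b; ext c; simp [smul_add, smul_smul, mul_comm])
    (by intro a b b'; ext c; simp; abel)
    (by intro r a b; ext c; simp [smul_add, smul_smul, mul_comm])

theorem ltp_apply (m : BilinOp F V) (a b c : V) :
    ltp m a b c = (2 : F) • m (m a b) c + m a (m b c) + m (m a c) b := by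
  simp [ltp]

/-- Left side minus right side of the first Leibniz triple system identity
`⟨a,⟨b,c,d⟩,e⟩ = ⟨⟨a,b,c⟩,d,e⟩ - ⟨⟨a,c,b⟩,d,e⟩ - ⟨⟨a,d,b⟩,c,e⟩ + ⟨⟨a,d,c⟩,b,e⟩`,
for a trilinear operation `t`. -/
def ltsExpr₁ (t : TrilinOp F V) (a b c d e : V) : V :=
  t a (t b c d) e -
    (t (t a b c) d e - t (t a c b) d e - t (t a d b) c e + t (t a d c) b e)

/-- Left side minus right side of the second Leibniz triple system identity
`⟨a,b,⟨c,d,e⟩⟩ = ⟨⟨a,b,c⟩,d,e⟩ - ⟨⟨a,b,d⟩,c,e⟩ - ⟨⟨a,b,e⟩,c,d⟩ + ⟨⟨a,b,e⟩,d,c⟩`,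
for a trilinear operation `t`. -/
def ltsExpr₂ (t : TrilinOp F V) (a b c d e : V) : V :=
  t a b (t c d e) -
    (t (t a b c) d e - t (t a b d) c e - t (t a b e) c d + t (t a b e) d c)

/-- The trilinear operation `t` makes `V` into a Leibniz triple system. -/
structure IsLeibnizTripleSystem (t : TrilinOp F V) : Prop where
  identity₁ : ∀ a b c d e : V, ltsExpr₁ t a b c d e = 0
  identity₂ : ∀ a b c d e : V, ltsExpr₂ t a b c d e = 0

end Structures

/-- Nonassociative monomials in a ternary operation, with variables in `X`. -/
inductive TernaryMonomial (X : Type v) : Type v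
  | var (x : X) : TernaryMonomial X
  | triple (p q r : TernaryMonomial X) : TernaryMonomial X

namespace TernaryMonomial

/-- The degree of a monomial: its number of variables, counted with multiplicity. -/
def degree {X : Type v} : TernaryMonomial X → ℕ
  | var _ => 1
  | triple p q r => p.degree + q.degree + r.degree

/-- The value of a monomial at a point `x`, for a trilinear operation `t`. -/
def eval {F : Type u} {V : Type w} [Field F] [AddCommGroup V] [Module F V] {X : Type v}
    (t : TrilinOp F V) (x : X → V) : TernaryMonomial X → V
  | var i => x i
  | triple p q r => t (p.eval t x) (q.eval t x) (r.eval t x)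

end TernaryMonomial

/-- Polynomials in a ternary operation: the free trilinear algebra on `X` over `F`,
which has the monomials as a basis. -/
abbrev TernaryPoly (F : Type u) (X : Type v) [Field F] := TernaryMonomial X →₀ F

namespace TernaryPoly

variable {F : Type u} {X : Type v} [Field F]

/-- The variable `x`, as a polynomial. -/
noncomputable def var (x : X) : TernaryPoly F X := Finsupp.single (.var x) 1

/-- The trilinear operation of the free trilinear algebra: the trilinear extension of
`(p, q, r) ↦ ⟨p, q, r⟩` on monomials. -/
noncomputable def op : TrilinOp F (TernaryPoly F X) :=
  Finsupp.linearCombination F fun p =>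
    Finsupp.linearCombination F fun q =>
      Finsupp.linearCombination F fun r => Finsupp.single (.triple p q r) (1 : F)

theorem op_single (p q r : TernaryMonomial X) (a b c : F) :
    op (Finsupp.single p a) (Finsupp.single q b) (Finsupp.single r c) =
      Finsupp.single (.triple p q r) (a * b * c) := by
  simp only [op, Finsupp.linearCombination_single, LinearMap.smul_apply, Finsupp.smul_single,
    smul_eq_mul, mul_one, mul_assoc]

/-- The degree of a polynomial: the largest degree of a monomial that occurs in it
(`0` for the zero polynomial). -/
def degree (f : TernaryPoly F X) : ℕ := f.support.sup TernaryMonomial.degree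

/-- The value of a polynomial at a point `x`, for a trilinear operation `t`. -/
noncomputable def eval {V : Type w} [AddCommGroup V] [Module F V] (t : TrilinOp F V)
    (x : X → V) : TernaryPoly F X →ₗ[F] V :=
  Finsupp.linearCombination F (TernaryMonomial.eval t x)

/-- The substitution of the polynomials `s x` for the variables `x`. -/
noncomputable def subst (s : X → TernaryPoly F X) : TernaryPoly F X →ₗ[F] TernaryPoly F X :=
  eval op s

/-- The trilinear operation `t` satisfies the polynomial identity `f`. -/
def IsIdentityOf {V : Type w} [AddCommGroup V] [Module F V]
    (f : TernaryPoly F X) (t : TrilinOp F V) : Prop :=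
  ∀ x : X → V, eval t x f = 0

/-- A T-ideal: a subspace of the free trilinear algebra which is an ideal for the trilinear
operation and is closed under all substitutions. -/
structure IsTIdeal (I : Submodule F (TernaryPoly F X)) : Prop where
  op_left : ∀ f ∈ I, ∀ g h, op f g h ∈ I
  op_middle : ∀ f ∈ I, ∀ g h, op g f h ∈ I
  op_right : ∀ f ∈ I, ∀ g h, op g h f ∈ I
  subst_mem : ∀ s : X → TernaryPoly F X, ∀ f ∈ I, subst s f ∈ I

/-- `f` is a consequence of the identities in `S`: it lies in the T-ideal generated by `S`. -/
def IsConsequenceOf (f : TernaryPoly F X) (S : Set (TernaryPoly F X)) : Prop :=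
  f ∈ sInf {I : Submodule F (TernaryPoly F X) | IsTIdeal I ∧ S ⊆ I}

/-- The two defining identities of Leibniz triple systems, as polynomials in the
variables `0, 1, 2, 3, 4`. -/
noncomputable def ltsIdentities (F : Type u) [Field F] : Set (TernaryPoly F ℕ) :=
  {ltsExpr₁ op (var 0) (var 1) (var 2) (var 3) (var 4),
   ltsExpr₂ op (var 0) (var 1) (var 2) (var 3) (var 4)}

end TernaryPoly

/-! ### The Leibniz triple identities in a Malcev dialgebra. -/

section Malcev

variable {F : Type u} {V : Type v} [Field F] [AddCommGroup V] [Module F V]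

/-! Part (1) is a finite computation: each identity, expanded in the bilinear product, is an
explicit combination of degree-5 consequences of the di-Malcev identity, modulo right
anticommutativity.

For part (2), the two identities move inner triples to the first slot, so every `f` of degree at
most 5 is `g + i`, with `g` a combination of left-normed monomials and `i` a consequence
(`mem_leftNormedSpan_sup_ltsIdeal`). One Malcev dialgebra detects `g`: on `A × A`, with `A` free
associative and product `([x, y], py)`, the second component of `⟨u, v, w⟩` is three times the
associative product. At the generic point a left-normed monomial thus yields a power of 3 times its
word, and it is determined by its word. As 3 is invertible, these values are independent. By part
(1) `i` vanishes there; if `f` does too, then `g = 0` and `f = i`. -/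

theorem IsMalcevDialgebra.mul_anticomm {m : BilinOp F V} (hm : IsMalcevDialgebra m)
    (p x y : V) : m p (m x y) = -m p (m y x) :=
  eq_neg_of_add_eq_zero_left (hm.right_anticomm p x y)

/-- Inside a right argument, the inner product can be carried to the right of `z`, swapped there,
and carried back. -/
theorem IsMalcevDialgebra.mul_anticomm₁ {m : BilinOp F V} (hm : IsMalcevDialgebra m)
    (p x y z : V) : m p (m (m x y) z) = -m p (m (m y x) z) := by
  rw [hm.mul_anticomm p _ z, hm.mul_anticomm z, map_neg, neg_neg, hm.mul_anticomm p z]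

theorem IsMalcevDialgebra.mul_anticomm₂ {m : BilinOp F V} (hm : IsMalcevDialgebra m)
    (p x y z w : V) : m p (m (m (m x y) z) w) = -m p (m (m (m y x) z) w) := by
  rw [hm.mul_anticomm p _ w, hm.mul_anticomm₁ w, map_neg, neg_neg, hm.mul_anticomm p w]

theorem IsMalcevDialgebra.di_malcev_mul {m : BilinOp F V} (hm : IsMalcevDialgebra m)
    (a b c d e : V) :
    m (m (m (m a b) c) d - m (m (m a d) b) c - m (m a (m c d)) b - m (m a c) (m b d)
      - m a (m (m b c) d)) e = 0 := by
  rw [hm.di_malcev, map_zero, LinearMap.zero_apply]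

theorem IsMalcevDialgebra.mul_di_malcev {m : BilinOp F V} (hm : IsMalcevDialgebra m)
    (a b c d e : V) :
    m a (m (m (m b c) d) e - m (m (m b e) c) d - m (m b (m d e)) c - m (m b d) (m c e)
      - m b (m (m c d) e)) = 0 := by
  rw [hm.di_malcev, map_zero]

set_option maxHeartbeats 4000000 in
theorem IsMalcevDialgebra.ltsExpr₁_ltp {m : BilinOp F V} (hm : IsMalcevDialgebra m)
    (a b c d e : V) : ltsExpr₁ (ltp m) a b c d e = 0 := by
  have dm := hm.di_malcev
  have outside := hm.di_malcev_mul
  have inside := hm.mul_di_malcev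
  have anti := fun x y p => hm.mul_anticomm p x y
  have anti₁ := fun x y p z => hm.mul_anticomm₁ p x y z
  have anti₂ := fun x y p z w => hm.mul_anticomm₂ p x y z w
  have anti_mul := fun x p y z => hm.mul_anticomm p x (m y z)
  have anti_mul₁ := fun x p y z w => hm.mul_anticomm₁ p x (m y z) w
  have anti_pair := fun x y z w p => hm.mul_anticomm p (m x y) (m z w)
  -- A certificate: substitution instances of the di-Malcev identity (`dm`), and instances
  -- multiplied on the right (`outside`) or on the left (`inside`).
  linear_combination (norm := skip)
      (1 : F) • inside a d c b e + (1 : F) • outside a e d c b + (1 : F) • dm a (m c e) b d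
      + (-1 : F) • dm a e (m b c) d + (-1 : F) • dm (m a d) c e b + (1 : F) • outside a c e d b
      + (1 : F) • outside a b d e c + (-1 : F) • dm (m a e) d c b + (-2 : F) • dm (m a d) c b e
      + (1 : F) • inside a b d c e + (-3 : F) • outside a b c d e + (-1 : F) • dm a c e (m d b)
      + (-1 : F) • dm (m a c) d b e + (1 : F) • dm a e c (m b d) + (-1 : F) • outside a b d c e
      + (1 : F) • dm a b d (m c e) + (-2 : F) • dm a (m b c) d e + (1 : F) • dm a b c (m e d)
      + (-2 : F) • dm (m a d) e c b + (-1 : F) • dm (m a b) c e d + (-1 : F) • dm a e (m d c) b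
      + (-1 : F) • dm (m a c) e d b + (1 : F) • dm a (m e d) c b + (2 : F) • dm a (m c b) e d
      + (-1 : F) • outside a c d b e + (-1 : F) • dm (m a c) d e b + (-2 : F) • outside a d c b e
  -- Right arguments are brought to a normal form, products on the left and letters sorted. The
  -- variables are given explicitly so that each swap is oriented and rewriting terminates.
  simp only [ltsExpr₁, ltp_apply, map_add, map_sub, map_smul, map_neg, LinearMap.add_apply,
    LinearMap.sub_apply, LinearMap.smul_apply, LinearMap.neg_apply,
    anti c b, anti₁ c b, anti₂ c b, anti d b, anti₁ d b, anti d c, anti₁ d c, anti₂ d c, anti e b,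
    anti e c, anti₁ e c, anti e d, anti₁ e d, anti₂ e d, anti_mul b, anti_mul₁ b, anti_mul c,
    anti_mul d, anti_mul₁ d, anti_mul e, anti_mul₁ e, anti_pair c e b d]
  module

set_option maxHeartbeats 4000000 in
theorem IsMalcevDialgebra.ltsExpr₂_ltp {m : BilinOp F V} (hm : IsMalcevDialgebra m)
    (a b c d e : V) : ltsExpr₂ (ltp m) a b c d e = 0 := by
  have dm := hm.di_malcev
  have outside := hm.di_malcev_mul
  have inside := hm.mul_di_malcev
  have anti := fun x y p => hm.mul_anticomm p x y
  have anti₁ := fun x y p z => hm.mul_anticomm₁ p x y z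
  have anti₂ := fun x y p z w => hm.mul_anticomm₂ p x y z w
  have anti_mul := fun x p y z => hm.mul_anticomm p x (m y z)
  have anti_mul₁ := fun x p y z w => hm.mul_anticomm₁ p x (m y z) w
  linear_combination (norm := skip)
      (-2 : F) • dm a e b (m d c) + (-1 : F) • dm a b (m c e) d + (2 : F) • dm (m a b) d e c
      + (-2 : F) • outside a d c b e + (-2 : F) • dm a (m d c) e b + (1 : F) • dm (m a b) e c d
      + (1 : F) • outside a b e c d + (-1 : F) • dm a (m c e) b d + (1 : F) • dm a d (m e c) b
      + (-2 : F) • outside a c b d e + (-2 : F) • outside a b c d e + (1 : F) • outside a d b e c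
      + (1 : F) • dm a b c (m e d) + (1 : F) • dm a (m e d) c b + (1 : F) • outside a c e b d
      + (1 : F) • outside a e b c d + (1 : F) • dm a c b (m e d) + (1 : F) • outside a e d b c
      + (-2 : F) • dm a b e (m d c) + (1 : F) • dm (m a b) e d c + (2 : F) • dm (m a b) d c e
      + (1 : F) • outside a b d e c
  simp only [ltsExpr₂, ltp_apply, map_add, map_sub, map_smul, map_neg, LinearMap.add_apply,
    LinearMap.sub_apply, LinearMap.smul_apply, LinearMap.neg_apply,
    anti c b, anti₁ c b, anti d b, anti₁ d b, anti d c, anti₁ d c, anti₂ d c, anti e b, anti₁ e b,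
    anti e c, anti₁ e c, anti e d, anti₁ e d, anti₂ e d, anti_mul b, anti_mul₁ b, anti_mul c,
    anti_mul₁ d, anti_mul e]
  module

theorem IsMalcevDialgebra.isLeibnizTripleSystem_ltp {m : BilinOp F V}
    (hm : IsMalcevDialgebra m) : IsLeibnizTripleSystem (ltp m) :=
  ⟨hm.ltsExpr₁_ltp, hm.ltsExpr₂_ltp⟩

end Malcev

/-! ### The separating Malcev dialgebra. -/

section HemisemidirectProduct

variable (F : Type u) (A : Type v) [Field F] [Ring A] [Algebra F A]

/-- The product `(x, p)(y, q) = ([x, y], py)` on `A × A`, for an associative algebra `A`. -/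
def hemisemidirectMul : BilinOp F (A × A) :=
  LinearMap.mk₂ F (fun u v => (u.1 * v.1 - v.1 * u.1, u.2 * v.1))
    (by intro u u' v; ext <;> simp [add_mul, mul_add]; abel)
    (by intro r u v; ext <;> simp [smul_sub])
    (by intro u v v'; ext <;> simp [add_mul, mul_add]; abel)
    (by intro r u v; ext <;> simp [smul_sub])

variable {F A}

theorem hemisemidirectMul_apply (u v : A × A) :
    hemisemidirectMul F A u v = (u.1 * v.1 - v.1 * u.1, u.2 * v.1) := rfl

theorem isMalcevDialgebra_hemisemidirectMul : IsMalcevDialgebra (hemisemidirectMul F A) where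
  right_anticomm a b c := by
    ext <;> simp only [hemisemidirectMul_apply, Prod.fst_add, Prod.snd_add, Prod.fst_zero,
      Prod.snd_zero] <;> noncomm_ring
  di_malcev a b c d := by
    ext <;> simp only [hemisemidirectMul_apply, Prod.fst_sub, Prod.snd_sub, Prod.fst_zero,
      Prod.snd_zero] <;> noncomm_ring

/-- With `p = u.2`, `2pvw + p[v, w] + pwv = 3pvw`: the commutator cancels the reversed term. -/
theorem ltp_hemisemidirectMul_snd (u v w : A × A) :
    (ltp (hemisemidirectMul F A) u v w).2 = (3 : F) • (u.2 * v.1 * w.1) := by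
  have h : (3 : F) = 2 + 1 := by norm_num
  rw [ltp_apply, h, add_smul, one_smul]
  simp only [hemisemidirectMul_apply, Prod.snd_add, Prod.smul_snd, mul_sub, ← mul_assoc]
  abel

end HemisemidirectProduct

/-! ### Words and left-normed monomials. -/

namespace TernaryMonomial

variable {X : Type v}

/-- The product of the variables of a monomial, from left to right. -/
def word : TernaryMonomial X → FreeMonoid X
  | var x => FreeMonoid.of x
  | triple p q r => p.word * q.word * r.word

/-- The left-normed monomials `⟨⟨⟨x, y, z⟩, u, v⟩, …⟩`. -/
inductive IsLeftNormed : TernaryMonomial X → Prop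
  | var (x : X) : IsLeftNormed (var x)
  | triple {p : TernaryMonomial X} (hp : IsLeftNormed p) (y z : X) :
      IsLeftNormed (triple p (.var y) (.var z))

theorem length_word_pos (p : TernaryMonomial X) : 0 < p.word.length := by
  induction p with
  | var x => simp [word]
  | triple p q r hp _ _ => simp [word, FreeMonoid.length_mul]; omega

/-- The bracketing is forced, so peeling off the last two letters recovers the monomial. -/
theorem IsLeftNormed.eq_of_word_eq {p q : TernaryMonomial X} (hp : p.IsLeftNormed)
    (hq : q.IsLeftNormed) (h : p.word = q.word) : p = q := by
  induction hp generalizing q with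
  | var x =>
    cases hq with
    | var y => rw [FreeMonoid.of_injective h]
    | @triple q' hq' y z =>
      have h' := congrArg FreeMonoid.length h
      have := q'.length_word_pos
      simp only [word, FreeMonoid.length_mul, FreeMonoid.length_of] at h'
      omega
  | @triple p' hp' y z ih =>
    cases hq with
    | var x =>
      have h' := congrArg FreeMonoid.length h
      have := p'.length_word_pos
      simp only [word, FreeMonoid.length_mul, FreeMonoid.length_of] at h'
      omega
    | @triple q' hq' y' z' =>
      have h' := congrArg FreeMonoid.toList h
      simp only [word, FreeMonoid.toList_mul, FreeMonoid.toList_of] at h'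
      obtain ⟨h₁, hz⟩ := List.append_inj' h' rfl
      obtain ⟨h₀, hy⟩ := List.append_inj' h₁ rfl
      obtain rfl : p' = q' := ih hq' (FreeMonoid.toList.injective h₀)
      simp_all

theorem degree_pos (p : TernaryMonomial X) : 0 < p.degree := by
  induction p with
  | var x => simp [degree]
  | triple p q r hp _ _ => simp only [degree]; omega

theorem exists_eq_var_of_degree_lt {p : TernaryMonomial X} (h : p.degree < 3) :
    ∃ x, p = .var x := by
  cases p with
  | var x => exact ⟨x, rfl⟩
  | triple p q r =>
    have := p.degree_pos
    have := q.degree_pos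
    have := r.degree_pos
    simp only [degree] at h
    omega

theorem exists_eq_triple_var_of_degree_lt {p : TernaryMonomial X} (h : p.degree < 5) :
    (∃ x, p = .var x) ∨ ∃ x y z, p = .triple (.var x) (.var y) (.var z) := by
  cases p with
  | var x => exact .inl ⟨x, rfl⟩
  | triple p q r =>
    have := p.degree_pos
    have := q.degree_pos
    have := r.degree_pos
    simp only [degree] at h
    obtain ⟨x, rfl⟩ := exists_eq_var_of_degree_lt (p := p) (by omega)
    obtain ⟨y, rfl⟩ := exists_eq_var_of_degree_lt (p := q) (by omega)
    obtain ⟨z, rfl⟩ := exists_eq_var_of_degree_lt (p := r) (by omega)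
    exact .inr ⟨x, y, z, rfl⟩

end TernaryMonomial

theorem FreeAlgebra.basisFreeMonoid_apply (R : Type u) (X : Type v) [CommSemiring R]
    (w : FreeMonoid X) :
    FreeAlgebra.basisFreeMonoid R X w = FreeMonoid.lift (FreeAlgebra.ι R) w := by
  have h : FreeAlgebra.basisFreeMonoid R X w =
      FreeAlgebra.equivMonoidAlgebraFreeMonoid.symm (MonoidAlgebra.of R (FreeMonoid X) w) := rfl
  rw [h]
  exact MonoidAlgebra.lift_of _ _

namespace TernaryPoly

open TernaryMonomial

/-! ### Evaluation and substitution. -/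

section Eval

variable {F : Type u} {X : Type v} {V : Type w} [Field F] [AddCommGroup V] [Module F V]

theorem eval_single (t : TrilinOp F V) (x : X → V) (p : TernaryMonomial X) (c : F) :
    eval t x (Finsupp.single p c) = c • p.eval t x := by
  simp [eval]

theorem eval_var (t : TrilinOp F V) (x : X → V) (i : X) :
    eval t x (var i : TernaryPoly F X) = x i := by
  simp [var, eval_single, TernaryMonomial.eval]

theorem eval_op (t : TrilinOp F V) (x : X → V) (f g h : TernaryPoly F X) :
    eval t x (op f g h) = t (eval t x f) (eval t x g) (eval t x h) := by
  induction f using Finsupp.induction_linear with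
  | zero => simp
  | add f f' hf hf' => simp [hf, hf']
  | single p a =>
    induction g using Finsupp.induction_linear with
    | zero => simp
    | add g g' hg hg' => simp [hg, hg']
    | single q b =>
      induction h using Finsupp.induction_linear with
      | zero => simp
      | add h h' hh hh' => simp [hh, hh']
      | single r c =>
        simp only [op_single, eval_single, TernaryMonomial.eval, map_smul, LinearMap.smul_apply,
          smul_smul]
        congr 1
        ring

theorem eval_subst (t : TrilinOp F V) (x : X → V) (s : X → TernaryPoly F X)
    (f : TernaryPoly F X) : eval t x (subst s f) = eval t (fun i => eval t x (s i)) f := by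
  induction f using Finsupp.induction_linear with
  | zero => simp
  | add f g hf hg => simp [hf, hg]
  | single p c =>
    rw [subst, eval_single, eval_single, map_smul]
    congr 1
    induction p with
    | var i => rfl
    | triple p q r hp hq hr => simp only [TernaryMonomial.eval, eval_op, hp, hq, hr]

theorem eval_ltsExpr₁ (t : TrilinOp F V) (x : X → V) (a b c d e : TernaryPoly F X) :
    eval t x (ltsExpr₁ op a b c d e) =
      ltsExpr₁ t (eval t x a) (eval t x b) (eval t x c) (eval t x d) (eval t x e) := by
  simp only [ltsExpr₁, map_add, map_sub, eval_op]

theorem eval_ltsExpr₂ (t : TrilinOp F V) (x : X → V) (a b c d e : TernaryPoly F X) :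
    eval t x (ltsExpr₂ op a b c d e) =
      ltsExpr₂ t (eval t x a) (eval t x b) (eval t x c) (eval t x d) (eval t x e) := by
  simp only [ltsExpr₂, map_add, map_sub, eval_op]

/-- The polynomial identities satisfied by a trilinear operation form a T-ideal. -/
theorem isTIdeal_iInf_ker_eval (t : TrilinOp F V) :
    IsTIdeal (⨅ x : X → V, LinearMap.ker (eval t x)) where
  op_left f hf g h := by
    simp only [Submodule.mem_iInf, LinearMap.mem_ker] at hf ⊢
    simp [eval_op, hf]
  op_middle f hf g h := by
    simp only [Submodule.mem_iInf, LinearMap.mem_ker] at hf ⊢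
    simp [eval_op, hf]
  op_right f hf g h := by
    simp only [Submodule.mem_iInf, LinearMap.mem_ker] at hf ⊢
    simp [eval_op, hf]
  subst_mem s f hf := by
    simp only [Submodule.mem_iInf, LinearMap.mem_ker] at hf ⊢
    simp [eval_subst, hf]

end Eval

/-! ### Reduction to left-normed monomials and their independence. -/

section Consequences

variable {F : Type u} [Field F]

theorem IsConsequenceOf.isIdentityOf {V : Type w} [AddCommGroup V] [Module F V]
    {t : TrilinOp F V} (ht : IsLeibnizTripleSystem t) {f : TernaryPoly F ℕ}
    (hf : f.IsConsequenceOf (ltsIdentities F)) : f.IsIdentityOf t := by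
  have h := (Submodule.mem_sInf.1 hf) _ ⟨isTIdeal_iInf_ker_eval t, by
    rintro g (rfl | rfl) <;>
      simp [eval_ltsExpr₁, eval_ltsExpr₂, ht.identity₁, ht.identity₂]⟩
  simpa [IsIdentityOf] using h

/-- The T-ideal generated by the identities of Leibniz triple systems. -/
noncomputable def ltsIdeal (F : Type u) [Field F] : Submodule F (TernaryPoly F ℕ) :=
  sInf {I | IsTIdeal I ∧ ltsIdentities F ⊆ I}

theorem ltsExpr₁_mem_ltsIdeal (a b c d e : TernaryPoly F ℕ) :
    ltsExpr₁ op a b c d e ∈ ltsIdeal F := by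
  refine Submodule.mem_sInf.2 fun I hI => ?_
  -- The default `0` is harmless: only the variables 0 to 4 occur.
  have h := hI.1.subst_mem (fun i => [a, b, c, d, e].getD i 0) _ (hI.2 (.inl rfl))
  simpa [subst, eval_ltsExpr₁, eval_var] using h

theorem ltsExpr₂_mem_ltsIdeal (a b c d e : TernaryPoly F ℕ) :
    ltsExpr₂ op a b c d e ∈ ltsIdeal F := by
  refine Submodule.mem_sInf.2 fun I hI => ?_
  have h := hI.1.subst_mem (fun i => [a, b, c, d, e].getD i 0) _ (hI.2 (.inr rfl))
  simpa [subst, eval_ltsExpr₂, eval_var] using h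

/-- The span of the left-normed monomials. -/
def leftNormedSpan (F : Type u) [Field F] : Submodule F (TernaryPoly F ℕ) :=
  Finsupp.supported F F {p | p.IsLeftNormed}

theorem op_op_var_mem_leftNormedSpan (a b c d e : ℕ) :
    op (op (var a) (var b) (var c)) (var d) (var e) ∈ leftNormedSpan F := by
  simp only [var, op_single]
  exact Finsupp.single_mem_supported _ _ (((IsLeftNormed.var a).triple b c).triple d e)

theorem single_mem_leftNormedSpan_sup_ltsIdeal {p : TernaryMonomial ℕ} (hp : p.degree ≤ 5) :
    Finsupp.single p (1 : F) ∈ leftNormedSpan F ⊔ ltsIdeal F := by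
  have normed {q : TernaryMonomial ℕ} (hq : q.IsLeftNormed) :
      Finsupp.single q (1 : F) ∈ leftNormedSpan F ⊔ ltsIdeal F :=
    Submodule.mem_sup_left (Finsupp.single_mem_supported _ _ hq)
  cases p with
  | var x => exact normed (.var x)
  | triple p q r =>
    have := p.degree_pos
    have := q.degree_pos
    have := r.degree_pos
    simp only [TernaryMonomial.degree] at hp
    have mem (a b c d e : ℕ) :=
      Submodule.mem_sup_left (T := ltsIdeal F) (op_op_var_mem_leftNormedSpan (F := F) a b c d e)
    rcases exists_eq_triple_var_of_degree_lt (p := p) (by omega) with ⟨a, rfl⟩ | ⟨a, b, c, rfl⟩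
    · rcases exists_eq_triple_var_of_degree_lt (p := q) (by omega) with ⟨b, rfl⟩ | ⟨b, c, d, rfl⟩
      · rcases exists_eq_triple_var_of_degree_lt (p := r) (by omega) with ⟨c, rfl⟩ | ⟨c, d, e, rfl⟩
        · exact normed ((IsLeftNormed.var a).triple b c)
        · have h : Finsupp.single (.triple (.var a) (.var b) (.triple (.var c) (.var d) (.var e)))
              (1 : F) = op (var a) (var b) (op (var c) (var d) (var e)) := by
            simp [var, op_single]
          -- The subtracted term is left open; unification with `ltsExpr₂` makes it the left-normed
          -- right-hand side of the identity.
          rw [h, ← sub_add_cancel (op _ _ _) (_ : TernaryPoly F ℕ)]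
          exact add_mem (Submodule.mem_sup_right
            (ltsExpr₂_mem_ltsIdeal (var a) (var b) (var c) (var d) (var e)))
            (add_mem (sub_mem (sub_mem (mem _ _ _ _ _) (mem _ _ _ _ _)) (mem _ _ _ _ _)) (mem _ _ _ _ _))
      · simp only [TernaryMonomial.degree] at hp
        obtain ⟨e, rfl⟩ := exists_eq_var_of_degree_lt (p := r) (by omega)
        have h : Finsupp.single (.triple (.var a) (.triple (.var b) (.var c) (.var d)) (.var e))
            (1 : F) = op (var a) (op (var b) (var c) (var d)) (var e) := by
          simp [var, op_single]
        rw [h, ← sub_add_cancel (op _ _ _) (_ : TernaryPoly F ℕ)]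
        exact add_mem (Submodule.mem_sup_right
          (ltsExpr₁_mem_ltsIdeal (var a) (var b) (var c) (var d) (var e)))
          (add_mem (sub_mem (sub_mem (mem _ _ _ _ _) (mem _ _ _ _ _)) (mem _ _ _ _ _)) (mem _ _ _ _ _))
    · simp only [TernaryMonomial.degree] at hp
      obtain ⟨d, rfl⟩ := exists_eq_var_of_degree_lt (p := q) (by omega)
      obtain ⟨e, rfl⟩ := exists_eq_var_of_degree_lt (p := r) (by omega)
      exact normed (((IsLeftNormed.var a).triple b c).triple d e)

theorem mem_leftNormedSpan_sup_ltsIdeal {f : TernaryPoly F ℕ} (hf : f.degree ≤ 5) :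
    f ∈ leftNormedSpan F ⊔ ltsIdeal F := by
  rw [← Finsupp.sum_single f]
  refine Submodule.sum_mem _ fun p hp => ?_
  rw [← mul_one (f p), ← smul_eq_mul, ← Finsupp.smul_single]
  exact Submodule.smul_mem _ _
    (single_mem_leftNormedSpan_sup_ltsIdeal ((Finset.le_sup hp).trans hf))

/-- Evaluation at the point `x ↦ (x, x)` of the hemisemidirect product of the free associative
algebra with itself. -/
noncomputable def freeEval (F : Type u) [Field F] :
    TernaryPoly F ℕ →ₗ[F] FreeAlgebra F ℕ × FreeAlgebra F ℕ :=
  eval (ltp (hemisemidirectMul F (FreeAlgebra F ℕ)))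
    fun i => (FreeAlgebra.ι F i, FreeAlgebra.ι F i)

theorem exists_freeEval_single_snd (h3 : (3 : F) ≠ 0) {p : TernaryMonomial ℕ}
    (hp : p.IsLeftNormed) : ∃ c : Fˣ, (freeEval F (Finsupp.single p 1)).2 =
      c • FreeAlgebra.basisFreeMonoid F ℕ p.word := by
  simp only [freeEval, eval_single, one_smul, FreeAlgebra.basisFreeMonoid_apply]
  induction hp with
  | var x => exact ⟨1, by simp [TernaryMonomial.eval, word]⟩
  | triple hp y z ih =>
    obtain ⟨c, hc⟩ := ih
    -- Each further triple contributes one factor 3.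
    refine ⟨Units.mk0 3 h3 * c, ?_⟩
    simp only [TernaryMonomial.eval, ltp_hemisemidirectMul_snd, hc, word, map_mul,
      FreeMonoid.lift_eval_of, mul_smul, smul_mul_assoc]
    rfl

theorem linearIndepOn_freeEval_single_snd (h3 : (3 : F) ≠ 0) :
    LinearIndepOn F (fun p => (freeEval F (Finsupp.single p 1)).2)
      {p : TernaryMonomial ℕ | p.IsLeftNormed} := by
  choose c hc using fun p : {p : TernaryMonomial ℕ | p.IsLeftNormed} =>
    exists_freeEval_single_snd h3 p.2
  have h : LinearIndependent F
      fun p : {p : TernaryMonomial ℕ | p.IsLeftNormed} =>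
        FreeAlgebra.basisFreeMonoid F ℕ p.1.word :=
    (FreeAlgebra.basisFreeMonoid F ℕ).linearIndependent.comp _
      fun p q hpq => Subtype.ext (p.2.eq_of_word_eq q.2 hpq)
  have e := h.units_smul c
  rwa [show c • _ = _ from (funext hc).symm] at e

theorem eq_zero_of_mem_leftNormedSpan (h3 : (3 : F) ≠ 0) {f : TernaryPoly F ℕ}
    (hf : f ∈ leftNormedSpan F) (h : freeEval F f = 0) : f = 0 := by
  refine linearIndepOn_iff.1 (linearIndepOn_freeEval_single_snd h3) f hf ?_
  have h' := congrArg Prod.snd h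
  rw [← Finsupp.sum_single f, Finsupp.sum, map_sum, Prod.snd_sum] at h'
  rw [Finsupp.linearCombination_apply, Finsupp.sum, ← Prod.snd_zero (M := FreeAlgebra F ℕ), ← h']
  refine Finset.sum_congr rfl fun p _ => ?_
  rw [← Prod.smul_snd, ← map_smul, Finsupp.smul_single, smul_eq_mul, mul_one]

end Consequences

end TernaryPoly

theorem mainTheorem3 (F : Type u) [Field F] (h2 : (2 : F) ≠ 0) :
    (∀ (M : Type v) [AddCommGroup M] [Module F M] (m : BilinOp F M),
      IsMalcevDialgebra m → IsLeibnizTripleSystem (ltp m)) ∧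
    ((3 : F) ≠ 0 → ∀ f : TernaryPoly F ℕ, f.degree = 5 →
      (∀ (M : Type u) [AddCommGroup M] [Module F M] (m : BilinOp F M),
        IsMalcevDialgebra m → f.IsIdentityOf (ltp m)) →
      f.IsConsequenceOf (TernaryPoly.ltsIdentities F)) := by
  refine ⟨fun M _ _ m hm => hm.isLeibnizTripleSystem_ltp, fun h3 f hdeg hf => ?_⟩
  obtain ⟨g, hg, i, hi, rfl⟩ :=
    Submodule.mem_sup.1 (TernaryPoly.mem_leftNormedSpan_sup_ltsIdeal hdeg.le)
  have hm := isMalcevDialgebra_hemisemidirectMul (F := F) (A := FreeAlgebra F ℕ)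
  have hi0 : TernaryPoly.freeEval F i = 0 :=
    TernaryPoly.IsConsequenceOf.isIdentityOf hm.isLeibnizTripleSystem_ltp hi _
  have hg0 : TernaryPoly.freeEval F g = 0 := by
    have h : TernaryPoly.freeEval F (g + i) = 0 := hf _ _ hm _
    rwa [map_add, hi0, add_zero] at h
  rw [TernaryPoly.eq_zero_of_mem_leftNormedSpan h3 hg hg0, zero_add]
  exact hi
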